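/- For an algebra $\mathbf A$ let $\operatorname{Var}(\mathbf A)$ denote the variety generated by $\mathbf A$, that is, the smallest class of algebras of the signature of $\mathbf A$ which contains $\mathbf A$ and is closed under homomorphic images, subalgebras and direct products. (Algebras are non-empty.) For algebras $\mathbf B, \mathbf C$ of the same signature write $\mathbf B \to \mathbf C$ if there is a homomorphism from $\mathbf B$ to $\mathbf C$, and write $\mathbf B \equiv \mathbf C$ if $\mathbf B \to \mathbf C$ and $\mathbf C \to \mathbf B$. The homomorphism lattice induced by a finite algebra $\mathbf A$ is the ordered set $$\mathbf L_{\mathbf A} := \langle \operatorname{Var}(\mathbf A)_{\mathrm{fin}}/{\equiv};\ \to\rangle$$ of the $\equiv$-classes of finite members of $\operatorname{Var}(\mathbf A)$, ordered by the relation induced by $\to$. A finite algebra $\mathbf Q$ is quasi-primal if the ternary discriminator operation $\tau$ on its universe, given by $\tau(x,y,z) = x$ if $x \neq y$ and $\tau(x,y,z) = z$ if $x = y$, is a term function of $\mathbf Q$. Theorem. For every (non-empty) finite distributive lattice $\mathbf L$ there exists a quasi-primal algebra $\mathbf Q$ such that the homomorphism lattice $\mathbf L_{\mathbf Q}$ is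 isomorphic to $\mathbf L$. -/

import Mathlib

open scoped FirstOrder

/-- A (non-empty) algebra of signature `S`. An algebraic signature is a first-order language
without relation symbols; its function symbols of arity `n` are the `n`-ary operation symbols. -/
structure Alg (S : FirstOrder.Language.{0, 0}) : Type 1 where
  carrier : Type
  [str : S.Structure carrier]
  [nonempty : Nonempty carrier]

namespace Alg

variable {S : FirstOrder.Language.{0, 0}}

instance : CoeSort (Alg S) Type := ⟨Alg.carrier⟩

instance (A : Alg S) : S.Structure A := A.str

instance (A : Alg S) : Nonempty A := A.nonempty

/-- The subalgebra of `A` with a given non-empty universe. -/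
def sub (A : Alg S) (U : S.Substructure A) (hU : Nonempty U) : Alg S where
  carrier := U
  nonempty := hU

/-- The direct product of a (possibly empty or infinite) family of algebras, with the
operations acting coordinatewise. -/
def prod {I : Type} (A : I → Alg S) : Alg S where
  carrier := ∀ i, A i
  str :=
    { funMap := fun f x i => FirstOrder.Language.Structure.funMap f (fun j => x j i)
      RelMap := fun r x => ∀ i, FirstOrder.Language.Structure.RelMap r (fun j => x j i) }

/-- A variety: a class of algebras closed under homomorphic images, subalgebras and products. -/
structure IsVariety (K : Alg S → Prop) : Prop where
  image : ∀ (A B : Alg S) (f : A →[S] B), Function.Surjective f → K A → K B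
  sub : ∀ (A : Alg S) (U : S.Substructure A) (hU : Nonempty U), K A → K (A.sub U hU)
  prod : ∀ (I : Type) (A : I → Alg S), (∀ i, K (A i)) → K (Alg.prod A)

/-- `Var A` is the variety generated by `A`, i.e. the smallest variety containing `A`. -/
def Var (A : Alg S) (B : Alg S) : Prop :=
  ∀ K : Alg S → Prop, IsVariety K → K A → K B

/-- The finite members of the variety generated by `A`. -/
def VarFin (A : Alg S) : Type 1 := {B : Alg S // Var A B ∧ Finite B}

/-- The homomorphism quasi-order: `B ≤ C` if there is a homomorphism from `B` to `C`. -/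
instance (A : Alg S) : Preorder (VarFin A) where
  le B C := Nonempty (B.1 →[S] C.1)
  le_refl B := ⟨FirstOrder.Language.Hom.id S B.1⟩
  le_trans _ _ _ := fun ⟨f⟩ ⟨g⟩ => ⟨g.comp f⟩

/-- The homomorphism lattice induced by `A`: the ordered set of the classes of homomorphically
equivalent finite members of the variety generated by `A`, with the order induced by the
existence of a homomorphism. -/
abbrev HomLattice (A : Alg S) : Type 1 := Antisymmetrization (VarFin A) (· ≤ ·)

open Classical in
/-- The ternary discriminator operation on a set. -/
noncomputable def discriminator {X : Type} (x y z : X) : X := if x = y then z else x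

/-- An algebra is quasi-primal if it is finite and the ternary discriminator operation is a
term function of it. -/
def IsQuasiPrimal (Q : Alg S) : Prop :=
  Finite Q ∧ ∃ t : S.Term (Fin 3), ∀ x y z : Q, t.realize ![x, y, z] = discriminator x y z

end Alg

/-! By Birkhoff's theorem `L` is the lattice of lower sets of a finite poset `P`, its
sup-irreducibles, so it suffices to realise `LowerSet P`. Over a quasi-primal `Q`, every finite `D`
in the variety is a direct product of subalgebras of `Q`: homomorphisms to `Q` separate its points
(`Var.separatedBy`), and a minimal separating family is independent
(`SeparatedBy.exists_independent`). So `C → D` holds once `C` maps to the image of each homomorphism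
`D → Q` (`SeparatedBy.nonempty_hom`), and the order depends only on which subalgebras of `Q` receive
a homomorphism. The algebra `alg P` lives on the tree of chains of `P`. A subalgebra containing a
root receives every algebra; any other is the cone below a node and, up to isomorphism, depends only
on the label `q` of that node (`exists_eq_cone`, `graftHom`): it is `branch q`. A product of
branches `branch (p i)` maps to `branch q` exactly when some `p i ≤ q`. Hence sending `C` to the set
of `q` with no homomorphism `C → branch q` embeds the homomorphism order in `LowerSet P`, and
products of branches make it onto. -/

namespace Alg

/-! ### Varieties generated by a quasi-primal algebra -/

section General

variable {S : FirstOrder.Language.{0, 0}}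

/-- In an algebraic signature a map which commutes with the operations is a homomorphism. -/
def homMk (hS : S.IsAlgebraic) {M N : Type*} [S.Structure M] [S.Structure N] (f : M → N)
    (hf : ∀ {n : ℕ} (o : S.Functions n) (x : Fin n → M),
      f (FirstOrder.Language.Structure.funMap o x) =
        FirstOrder.Language.Structure.funMap o (f ∘ x)) : M →[S] N where
  toFun := f
  map_fun' := hf
  map_rel' := fun r => ((hS _).false r).elim

/-- The `i`-th projection of a direct product. -/
def prodProj {I : Type} (A : I → Alg S) (i : I) : Alg.prod A →[S] A i where
  toFun := fun x => x i
  map_fun' := fun _ _ => rfl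
  map_rel' := fun _ _ h => h i

/-- The ternary operation defined by a ternary term. -/
def ternary (t : S.Term (Fin 3)) {M : Type*} [S.Structure M] (x y z : M) : M :=
  t.realize ![x, y, z]

/-- If `t` induces the discriminator, this is the operation with value `a` when `x = y`,
and `b` otherwise. -/
def switch (t : S.Term (Fin 3)) {M : Type*} [S.Structure M] (x y a b : M) : M :=
  ternary t (ternary t x y a) (ternary t x y b) b

theorem map_ternary (t : S.Term (Fin 3)) {M N : Type*} [S.Structure M] [S.Structure N]
    (h : M →[S] N) (x y z : M) : h (ternary t x y z) = ternary t (h x) (h y) (h z) := by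
  unfold ternary
  rw [← FirstOrder.Language.HomClass.realize_term h]
  congr 1
  ext i
  fin_cases i <;> rfl

theorem map_switch (t : S.Term (Fin 3)) {M N : Type*} [S.Structure M] [S.Structure N]
    (h : M →[S] N) (x y a b : M) : h (switch t x y a b) = switch t (h x) (h y) (h a) (h b) := by
  simp only [switch, map_ternary]

/-- The homomorphisms from `B` to `Q` separate the points of `B`. -/
def SeparatedBy (Q B : Alg S) : Prop := ∀ x y : B, (∀ h : B →[S] Q, h x = h y) → x = y

section Discriminator

variable {Q : Alg S} {t : S.Term (Fin 3)}
  (ht : ∀ x y z : Q, t.realize ![x, y, z] = discriminator x y z)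

include ht

theorem switch_self (x a b : Q) : switch t x x a b = a := by
  simp only [switch, ternary, ht, discriminator]
  by_cases h : a = b <;> simp [h]

theorem switch_of_ne {x y : Q} (h : x ≠ y) (a b : Q) : switch t x y a b = b := by
  simp [switch, ternary, ht, discriminator, h]

theorem SeparatedBy.switch_self {B : Alg S} (hB : SeparatedBy Q B) (x a b : B) :
    switch t x x a b = a :=
  hB _ _ fun h => by rw [map_switch, Alg.switch_self ht]

/-- In a quotient of an algebra separated by `Q`, two elements agree as soon as finitely many
equations of the quotient imply their equality in all coordinates. -/
theorem image_eq_of_finite {E D : Alg S} (hE : SeparatedBy Q E) (g : E →[S] D)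
    {T : Set (E × E)} (hT : T.Finite)
    (hgT : ∀ p ∈ T, g p.1 = g p.2) (a b : E)
    (hab : ∀ h : E →[S] Q, (∀ p ∈ T, h p.1 = h p.2) → h a = h b) : g a = g b := by
  induction T, hT using Set.Finite.induction_on generalizing a with
  | empty => exact congrArg g (hE a b fun h => hab h (by simp))
  | @insert p T _ _ ih =>
    have hp := hgT p (Set.mem_insert _ _)
    -- The switch equals `a` where equation `p` holds and `b` elsewhere, so it agrees with `b`
    -- without assuming `p`. Since `p` holds in `D`, its image there is `g a`.
    have h1 := ih (fun q hq => hgT q (Set.mem_insert_of_mem _ hq)) (switch t p.1 p.2 a b)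
      (fun h hh => by
        rw [map_switch]
        by_cases e : h p.1 = h p.2
        · rw [e, Alg.switch_self ht]
          refine hab h fun q hq => ?_
          rcases Set.mem_insert_iff.1 hq with rfl | hq
          exacts [e, hh q hq]
        · rw [switch_of_ne ht e])
    rw [← h1, map_switch, hp]
    obtain ⟨x, hx⟩ : ∃ x, g x = g p.2 := ⟨_, rfl⟩
    rw [← map_switch, hE.switch_self ht]

/-- A compactness argument. If `g a ≠ g b`, any finitely many pairs in the kernel of `g` are
identified by some homomorphism to `Q` separating `a` from `b`. As `Q` is finite, an ultrafilter
limit of such homomorphisms exists pointwise; it factors through `g` and still separates `a` from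
`b`. -/
theorem SeparatedBy.image (hS : S.IsAlgebraic) [Finite Q] {E D : Alg S} (hE : SeparatedBy Q E)
    (g : E →[S] D) (hg : Function.Surjective g) : SeparatedBy Q D := by
  intro x y hxy
  obtain ⟨a, rfl⟩ := hg x
  obtain ⟨b, rfl⟩ := hg y
  by_contra hne
  let F : Set (Set (E →[S] Q)) :=
    (fun p : E × E => {h : E →[S] Q | h p.1 = h p.2 ∧ h a ≠ h b}) '' {p | g p.1 = g p.2}
  have hF : (Filter.generate F).NeBot := by
    rw [Filter.generate_neBot_iff]
    intro s hs hfin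
    obtain ⟨T, hT, hTfin, rfl⟩ := Set.exists_subset_image_finite_and (p := (s = ·)).1 ⟨s, hs, hfin, rfl⟩
    by_contra hemp
    refine hne (image_eq_of_finite ht hE g (T := insert (a, a) T) (hTfin.insert _) ?_ a b ?_)
    · rintro p (rfl | hp)
      exacts [rfl, hT hp]
    · intro h hh
      by_contra hab
      refine hemp ⟨h, ?_⟩
      rintro _ ⟨p, hp, rfl⟩
      exact ⟨hh p (Set.mem_insert_of_mem _ hp), hab⟩
  let U := Ultrafilter.of (Filter.generate F)
  have hU : ∀ u v, g u = g v → ∀ᶠ h : E →[S] Q in U, h u = h v ∧ h a ≠ h b := fun u v huv =>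
    Ultrafilter.of_le _ (Filter.mem_generate_of_mem ⟨(u, v), huv, rfl⟩)
  have hlim : ∀ e : E, ∃ q : Q, ∀ᶠ h : E →[S] Q in U, h e = q := fun e =>
    Ultrafilter.eventually_exists_iff.1 (Filter.Eventually.of_forall fun h => ⟨h e, rfl⟩)
  choose lim hlim using hlim
  have huniq : ∀ (e : E) (q : Q), (∀ᶠ h : E →[S] Q in U, h e = q) → lim e = q := fun e q hq => by
    obtain ⟨h, h1, h2⟩ := ((hlim e).and hq).exists
    exact h1.symm.trans h2
  have hlimg : ∀ u v, g u = g v → lim u = lim v := fun u v huv => huniq _ _ <| by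
    filter_upwards [hU u v huv, hlim v] with h h1 h2
    exact h1.1.trans h2
  choose s hs using hg
  have key : ∀ e, lim (s (g e)) = lim e := fun e => hlimg _ _ (hs _)
  let k : D →[S] Q := homMk hS (fun d => lim (s d)) (by
    intro n o x
    have : FirstOrder.Language.Structure.funMap o x =
        g (FirstOrder.Language.Structure.funMap o (s ∘ x)) := by
      rw [g.map_fun]
      congr 1
      ext i
      exact (hs _).symm
    rw [this, key]
    refine huniq _ _ ?_
    have hall : ∀ᶠ h : E →[S] Q in U, ∀ i, h (s (x i)) = lim (s (x i)) :=
      Filter.eventually_all.2 fun i => hlim _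
    filter_upwards [hall] with h hh
    rw [h.map_fun]
    congr 1
    ext i
    exact hh i)
  have h1 : lim (s (g a)) = lim (s (g b)) := hxy k
  rw [key, key] at h1
  obtain ⟨h, ⟨h2, h3⟩, h4⟩ := ((hlim a).and (hlim b) |>.and (hU a a rfl)).exists
  exact h4.2 (h2.trans (h1.trans h3.symm))

theorem isVariety_separatedBy (hS : S.IsAlgebraic) [Finite Q] :
    IsVariety (SeparatedBy Q) where
  image _ _ f hf hA := hA.image ht hS f hf
  sub _ U _ hA := fun _ _ hxy =>
    Subtype.ext (hA _ _ fun h => hxy (h.comp U.subtype.toHom))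
  prod _ A hA := fun _ _ hxy =>
    funext fun i => hA i _ _ fun h => hxy (h.comp (prodProj A i))

theorem Var.separatedBy (hS : S.IsAlgebraic) [Finite Q] {B : Alg S} (hB : Var Q B) :
    SeparatedBy Q B :=
  hB _ (isVariety_separatedBy ht hS) fun _ _ h => h (FirstOrder.Language.Hom.id S Q)

/-- A finite algebra separated by `Q` has a finite separating family of homomorphisms to `Q`
which maps it onto the direct product of their images. -/
theorem SeparatedBy.exists_independent [Finite Q] {D : Alg S} [Finite D] (hD : SeparatedBy Q D) :
    ∃ J : Set (D →[S] Q), ∀ c : (D →[S] Q) → D, ∃! x : D, ∀ h ∈ J, h x = h (c h) := by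
  have : Finite (D →[S] Q) := DFunLike.finite _
  obtain ⟨J, hJ⟩ := exists_minimal_of_wellFoundedLT
    (fun J : Set (D →[S] Q) => ∀ x y : D, (∀ h ∈ J, h x = h y) → x = y)
    ⟨Set.univ, fun x y h => hD x y fun k => h k trivial⟩
  -- By minimality each `j` is the only member of `J` separating some pair.
  have hsep : ∀ j ∈ J, ∃ a b : D, (∀ h ∈ J, h ≠ j → h a = h b) ∧ j a ≠ j b := by
    intro j hj
    by_contra! hcon
    have h1 : J ⊆ J \ {j} := hJ.2 (y := J \ {j}) (fun x y hxy => hJ.1 x y fun h hh => by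
      by_cases e : h = j
      · subst e
        exact hcon x y fun k hk hkj => hxy k ⟨hk, hkj⟩
      · exact hxy h ⟨hh, e⟩) Set.sdiff_subset
    exact (h1 hj).2 rfl
  refine ⟨J, fun c => ?_⟩
  suffices hex : ∀ F : Set (D →[S] Q), F ⊆ J → ∃ x : D, ∀ h ∈ F, h x = h (c h) by
    obtain ⟨x, hx⟩ := hex J subset_rfl
    exact ⟨x, hx, fun y hy => hJ.1 y x fun h hh => (hy h hh).trans (hx h hh).symm⟩
  intro F hFJ
  induction F, F.toFinite using Set.Finite.induction_on with
  | empty => exact ⟨Classical.arbitrary D, by simp⟩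
  | @insert j F hj _ ih =>
    obtain ⟨x, hx⟩ := ih fun h hh => hFJ (Set.mem_insert_of_mem _ hh)
    obtain ⟨a, b, hab, hne⟩ := hsep j (hFJ (Set.mem_insert _ _))
    -- Among the members of `J`, only `j` sees `a ≠ b`, so only the `j`-coordinate of `x` is
    -- changed.
    refine ⟨switch t a b x (c j), ?_⟩
    rintro h (rfl | hh)
    · rw [map_switch, switch_of_ne ht hne]
    · have hhj : h ≠ j := fun e => hj (e ▸ hh)
      rw [map_switch, hab h (hFJ (Set.mem_insert_of_mem _ hh)) hhj, Alg.switch_self ht, hx h hh]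

/-- A finite algebra `D` separated by `Q` admits a homomorphism from `C` as soon as `C` maps
to the image of each homomorphism from `D` to `Q`. -/
theorem SeparatedBy.nonempty_hom (hS : S.IsAlgebraic) [Finite Q] {C D : Alg S} [Finite D]
    (hD : SeparatedBy Q D) (hC : ∀ h : D →[S] Q, Nonempty (C →[S] h.range)) :
    Nonempty (C →[S] D) := by
  obtain ⟨J, hJ⟩ := hD.exists_independent ht
  let k : ∀ h : D →[S] Q, C →[S] h.range := fun h => (hC h).some
  have hk : ∀ c : C, ∃ x : D, ∀ h ∈ J, h x = k h c := fun c => by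
    have hmem : ∀ h : D →[S] Q, ∃ d, h d = k h c := fun h =>
      FirstOrder.Language.Hom.mem_range.1 (k h c).2
    choose d hd using hmem
    obtain ⟨x, hx, -⟩ := hJ d
    exact ⟨x, fun h hh => (hx h hh).trans (hd h)⟩
  choose f hf using hk
  refine ⟨homMk hS f fun {n} o x => ?_⟩
  refine (hJ fun _ => FirstOrder.Language.Structure.funMap o (f ∘ x)).unique ?_ (fun _ _ => rfl)
  intro h hh
  rw [hf _ h hh, h.map_fun, (k h).map_fun]
  have := (h.range.subtype).map_fun o (k h ∘ x)
  refine this.trans (congrArg _ (funext fun i => ?_))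
  exact (hf _ h hh).symm

end Discriminator

end General

end Alg

/-! ### The algebra on the tree of chains of `P` -/

namespace ChainAlg

open FirstOrder FirstOrder.Language Alg

/-- Operation symbols of the quasi-primal algebra built from the poset `P`. -/
inductive Op (P : Type) : ℕ → Type
  | descend (r : P) : Op P 1
  | flip (r : P) : Op P 1
  | ascend : Op P 2
  | disc : Op P 3

/-- The algebraic signature with operation symbols `Op P`. -/
def sig (P : Type) : FirstOrder.Language.{0, 0} := ⟨Op P, fun _ => Empty⟩

theorem isAlgebraic_sig (P : Type) : (sig P).IsAlgebraic := fun _ => inferInstanceAs (IsEmpty Empty)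

variable {P : Type} [PartialOrder P]

/-- Strictly increasing lists in `P`, regarded as the nodes of a tree with root `[]` in which
the parent of `r :: σ` is `σ`; each node has two copies. -/
@[ext]
structure Univ (P : Type) [PartialOrder P] where
  /-- The node of an element. -/
  node : List P
  isChain_node : node.IsChain (· < ·)
  /-- The copy of the node to which an element belongs. -/
  copy : Bool

instance [Finite P] : Finite (Univ P) := by
  classical
  have : Fintype P := Fintype.ofFinite P
  refine Finite.of_injective (β := {l : List P // l.Nodup} × Bool)
    (fun x => (⟨x.node, (List.isChain_iff_pairwise.1 x.isChain_node).imp ne_of_lt⟩, x.copy))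
    fun x y h => ?_
  exact Univ.ext (congrArg (fun z => z.1.1) h) (congrArg Prod.snd h)

namespace Univ

open Classical in
/-- Move to the child with label `r`, if there is one; the root is fixed. -/
noncomputable def descend (r : P) (x : Univ P) : Univ P :=
  if h : (r :: x.node).IsChain (· < ·) ∧ x.node ≠ [] then ⟨r :: x.node, h.1, x.copy⟩ else x

open Classical in
/-- Exchange the two copies of the nodes with label `r`. -/
noncomputable def flip (r : P) (x : Univ P) : Univ P :=
  if x.node.head? = some r then ⟨x.node, x.isChain_node, !x.copy⟩ else x

open Classical in
/-- Move from `x` to its parent unless `y` is below `x`. -/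
noncomputable def ascend (x y : Univ P) : Univ P :=
  if x.node <:+ y.node then x else ⟨x.node.tail, x.isChain_node.tail, x.copy⟩

end Univ

noncomputable instance : (sig P).Structure (Univ P) where
  funMap {_} o := match o with
    | Op.descend r => fun x => (x 0).descend r
    | Op.flip r => fun x => (x 0).flip r
    | Op.ascend => fun x => (x 0).ascend (x 1)
    | Op.disc => fun x => discriminator (x 0) (x 1) (x 2)
  RelMap r := nomatch r

/-- The root of the tree. -/
def root : Univ P := ⟨[], List.isChain_nil, true⟩

instance : Nonempty (Univ P) := ⟨root⟩

/-- The quasi-primal algebra built from the poset `P`. -/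
noncomputable def alg (P : Type) [PartialOrder P] : Alg (sig P) where
  carrier := Univ P

/-- A set closed under the first three kinds of operations is a subuniverse. -/
theorem closed_of {U : Set (Univ P)} (h1 : ∀ r, ∀ x ∈ U, x.descend r ∈ U)
    (h2 : ∀ r, ∀ x ∈ U, x.flip r ∈ U) (h3 : ∀ x ∈ U, ∀ y ∈ U, x.ascend y ∈ U) {n : ℕ}
    (o : (sig P).Functions n) : ClosedUnder o U := by
  intro x hx
  cases o with
  | descend r => exact h1 r _ (hx 0)
  | flip r => exact h2 r _ (hx 0)
  | ascend => exact h3 _ (hx 0) _ (hx 1)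
  | disc =>
    change discriminator (x 0) (x 1) (x 2) ∈ U
    unfold discriminator
    split_ifs
    exacts [hx 2, hx 0]

section Closure

variable (U : (sig P).Substructure (alg P)) {x y : Univ P}

theorem descend_mem (r : P) (hx : x ∈ U) : x.descend r ∈ U :=
  U.fun_mem (n := 1) (Op.descend r) (fun _ => x) fun _ => hx

theorem flip_mem (r : P) (hx : x ∈ U) : x.flip r ∈ U :=
  U.fun_mem (n := 1) (Op.flip r) (fun _ => x) fun _ => hx

theorem ascend_mem (hx : x ∈ U) (hy : y ∈ U) : x.ascend y ∈ U :=
  U.fun_mem (n := 2) Op.ascend ![x, y] fun i => by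
    fin_cases i
    exacts [hx, hy]

end Closure

theorem isQuasiPrimal_alg [Finite P] : (alg P).IsQuasiPrimal :=
  ⟨inferInstanceAs (Finite (Univ P)),
    Term.func (L := sig P) (l := 3) Op.disc (fun i => Term.var i), fun _ _ _ => rfl⟩

theorem descend_node {r : P} {x : Univ P} (h : (r :: x.node).IsChain (· < ·)) (hx : x.node ≠ []) :
    (x.descend r).node = r :: x.node ∧ (x.descend r).copy = x.copy := by
  unfold Univ.descend
  rw [dif_pos ⟨h, hx⟩]
  exact ⟨rfl, rfl⟩

/-- Roots must be idempotent; this is why `Univ.descend` fixes them. -/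
theorem funMap_root {x : Univ P} (hx : x.node = []) {n : ℕ} (o : (sig P).Functions n) :
    Structure.funMap (M := Univ P) o (fun _ => x) = x := by
  cases o with
  | descend r => exact dif_neg fun h => h.2 hx
  | flip r => exact if_neg (by simp [hx])
  | ascend => exact if_pos List.suffix_rfl
  | disc => exact if_pos rfl

/-- A subuniverse containing a root is the target of a constant homomorphism. -/
theorem nonempty_hom_of_root (C : Alg (sig P)) (U : (sig P).Substructure (alg P)) {x : Univ P}
    (hxU : x ∈ U) (hx : x.node = []) : Nonempty (C →[sig P] U) :=
  ⟨homMk (isAlgebraic_sig P) (fun _ => ⟨x, hxU⟩) fun o _ => Subtype.ext (funMap_root hx o).symm⟩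

/-! ### Cones and the classification of subuniverses -/

/-- The subuniverse of the elements at or below the node `σ`. -/
def cone (σ : List P) : (sig P).Substructure (alg P) where
  carrier := {x : Univ P | σ <:+ x.node}
  fun_mem := by
    refine closed_of (fun r x hx => ?_) (fun r x hx => ?_) (fun x hx y hy => ?_)
    · change σ <:+ _ at hx ⊢
      unfold Univ.descend
      split_ifs
      exacts [hx.trans (List.suffix_cons _ _), hx]
    · change σ <:+ _ at hx ⊢
      unfold Univ.flip
      split_ifs
      exacts [hx, hx]
    · change σ <:+ _ at hx ⊢
      unfold Univ.ascend
      split_ifs with h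
      · exact hx
      · obtain ⟨w, hw⟩ := hx
        cases w with
        | nil => exact (h (by rw [← hw]; exact hy)).elim
        | cons a w => exact ⟨w, by change _ = x.node.tail; rw [← hw]; rfl⟩

/-- Only the first entry of `σ` meets `w`, so the tree below a node depends on its label alone. -/
theorem isChain_append_congr {σ τ : List P} (hσ : σ.IsChain (· < ·)) (hτ : τ.IsChain (· < ·))
    (h : σ.head? = τ.head?) (w : List P) :
    (w ++ σ).IsChain (· < ·) ↔ (w ++ τ).IsChain (· < ·) := by
  simp only [List.isChain_append, hσ, hτ, h]

/-- Replace the final part `σ` of the node of `x` by `τ`. -/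
noncomputable def graft (σ τ : List P) (hσ : σ.IsChain (· < ·)) (hτ : τ.IsChain (· < ·))
    (h : σ.head? = τ.head?) (x : cone σ) : Univ P :=
  ⟨x.2.choose ++ τ, (isChain_append_congr hσ hτ h _).1 (by
    rw [x.2.choose_spec]; exact Univ.isChain_node x.1), Univ.copy x.1⟩

section Graft

variable {σ τ : List P} (hσ : σ.IsChain (· < ·)) (hτ : τ.IsChain (· < ·))
  (h : σ.head? = τ.head?)

theorem graft_node {x : cone σ} {w : List P} (hw : Univ.node x.1 = w ++ σ) :
    (graft σ τ hσ hτ h x).node = w ++ τ := by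
  have h1 : x.2.choose ++ σ = w ++ σ := x.2.choose_spec.trans hw
  change x.2.choose ++ τ = w ++ τ
  rw [(List.append_left_inj σ).1 h1]

theorem graft_injective : Function.Injective (graft σ τ hσ hτ h) := by
  intro x y hxy
  obtain ⟨u, hu⟩ := x.2
  obtain ⟨v, hv⟩ := y.2
  have h1 := congrArg Univ.node hxy
  rw [graft_node hσ hτ h hu.symm, graft_node hσ hτ h hv.symm] at h1
  have h2 := (List.append_left_inj τ).1 h1
  have h3 := congrArg Univ.copy hxy
  refine Subtype.ext (Univ.ext ?_ h3)
  exact hu.symm.trans ((congrArg (· ++ σ) h2).trans hv)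

/-- Cones below nodes with the same label are isomorphic. -/
noncomputable def graftHom (hne : σ ≠ []) : cone σ →[sig P] cone τ :=
  homMk (isAlgebraic_sig P)
    (fun x => ⟨graft σ τ hσ hτ h x, x.2.choose, rfl⟩) (by
    have hne' : τ ≠ [] := by
      rintro rfl
      exact hne (by simpa using h)
    intro n o x
    refine Subtype.ext ?_
    have key : ∀ i, ∃ w, Univ.node (x i).1 = w ++ σ := fun i =>
      (x i).2.imp fun _ => Eq.symm
    choose w hw using key
    have hw' := fun i => graft_node hσ hτ h (hw i)
    cases o with
    | descend r =>
      change graft σ τ hσ hτ h ⟨Univ.descend r (x 0).1, _⟩ =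
        Univ.descend r (graft σ τ hσ hτ h (x 0))
      have hiff : (r :: Univ.node (x 0).1).IsChain (· < ·) ↔
          (r :: (graft σ τ hσ hτ h (x 0)).node).IsChain (· < ·) := by
        rw [hw, hw']
        exact isChain_append_congr hσ hτ h (r :: w 0)
      have hn : Univ.node (x 0).1 ≠ [] := by simp [hw, hne]
      have hn' : (graft σ τ hσ hτ h (x 0)).node ≠ [] := by simp [hw', hne']
      by_cases hc : (r :: Univ.node (x 0).1).IsChain (· < ·)
      · obtain ⟨h1, h2⟩ := descend_node hc hn
        obtain ⟨h3, h4⟩ := descend_node (hiff.1 hc) hn'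
        refine Univ.ext ?_ (h2.trans h4.symm)
        rw [h3, hw' 0]
        refine graft_node (w := r :: w 0) hσ hτ h ?_
        rw [h1, hw]
        rfl
      · have h1 : Univ.descend r (x 0).1 = (x 0).1 := dif_neg fun hh => hc hh.1
        have h2 : Univ.descend r (graft σ τ hσ hτ h (x 0)) = graft σ τ hσ hτ h (x 0) :=
          dif_neg fun hh => hc (hiff.2 hh.1)
        rw [h2]
        congr 1
        exact Subtype.ext h1
    | flip r =>
      change graft σ τ hσ hτ h ⟨Univ.flip r (x 0).1, _⟩ =
        Univ.flip r (graft σ τ hσ hτ h (x 0))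
      have hiff : (Univ.node (x 0).1).head? = (graft σ τ hσ hτ h (x 0)).node.head? := by
        rw [hw, hw', List.head?_append, List.head?_append, h]
      by_cases hc : (Univ.node (x 0).1).head? = some r
      · have h1 : Univ.flip r (x 0).1 =
            ⟨Univ.node (x 0).1, Univ.isChain_node (x 0).1, !Univ.copy (x 0).1⟩ := if_pos hc
        have h2 : Univ.flip r (graft σ τ hσ hτ h (x 0)) =
          ⟨_, (graft σ τ hσ hτ h (x 0)).isChain_node, !(graft σ τ hσ hτ h (x 0)).copy⟩ :=
            if_pos (hiff ▸ hc)
        rw [h2]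
        refine Univ.ext ?_ ?_
        · refine (graft_node hσ hτ h (w := w 0) ?_).trans (hw' 0).symm
          exact (congrArg Univ.node h1).trans (hw 0)
        · have h3 := congrArg Univ.copy h1
          exact h3
      · have h1 : Univ.flip r (x 0).1 = (x 0).1 := if_neg hc
        have h2 : Univ.flip r (graft σ τ hσ hτ h (x 0)) = graft σ τ hσ hτ h (x 0) :=
          if_neg (hiff ▸ hc)
        rw [h2]
        congr 1
        exact Subtype.ext h1
    | ascend =>
      change graft σ τ hσ hτ h ⟨Univ.ascend (x 0).1 (x 1).1, _⟩ =
        Univ.ascend (graft σ τ hσ hτ h (x 0)) (graft σ τ hσ hτ h (x 1))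
      have hiff : Univ.node (x 0).1 <:+ Univ.node (x 1).1 ↔
          (graft σ τ hσ hτ h (x 0)).node <:+ (graft σ τ hσ hτ h (x 1)).node := by
        rw [hw, hw, hw', hw', List.suffix_append_self_iff, List.suffix_append_self_iff]
      by_cases hc : Univ.node (x 0).1 <:+ Univ.node (x 1).1
      · have h1 : Univ.ascend (x 0).1 (x 1).1 = (x 0).1 := if_pos hc
        have h2 : Univ.ascend (graft σ τ hσ hτ h (x 0)) (graft σ τ hσ hτ h (x 1)) =
          graft σ τ hσ hτ h (x 0) := if_pos (hiff.1 hc)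
        rw [h2]
        congr 1
        exact Subtype.ext h1
      · have hw0 : w 0 ≠ [] := by
          intro h0
          rw [hw, hw, h0] at hc
          exact hc (List.suffix_append _ _)
        have h1 : Univ.ascend (x 0).1 (x 1).1 = _ := if_neg hc
        have h2 : Univ.ascend (graft σ τ hσ hτ h (x 0)) (graft σ τ hσ hτ h (x 1)) = _ :=
          if_neg fun hh => hc (hiff.2 hh)
        rw [h2]
        refine Univ.ext ?_ ?_
        · refine (graft_node hσ hτ h (w := (w 0).tail) ?_).trans ?_
          · refine (congrArg Univ.node h1).trans ?_
            change (Univ.node (x 0).1).tail = _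
            rw [hw, List.tail_append_of_ne_nil hw0]
          · change _ = (graft σ τ hσ hτ h (x 0)).node.tail
            rw [hw', List.tail_append_of_ne_nil hw0]
        · have h3 := congrArg Univ.copy h1
          exact h3
    | disc =>
      change graft σ τ hσ hτ h ⟨discriminator (x 0).1 (x 1).1 (x 2).1, _⟩ =
        discriminator (graft σ τ hσ hτ h (x 0)) (graft σ τ hσ hτ h (x 1))
          (graft σ τ hσ hτ h (x 2))
      by_cases hc : x 0 = x 1
      · have h1 : discriminator (x 0).1 (x 1).1 (x 2).1 = (x 2).1 :=
          if_pos (congrArg Subtype.val hc)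
        have h2 : discriminator (graft σ τ hσ hτ h (x 0)) (graft σ τ hσ hτ h (x 1))
          (graft σ τ hσ hτ h (x 2)) = graft σ τ hσ hτ h (x 2) := if_pos (by rw [hc])
        rw [h2]
        congr 1
        exact Subtype.ext h1
      · have h1 : discriminator (x 0).1 (x 1).1 (x 2).1 = (x 0).1 :=
          if_neg fun e => hc (Subtype.ext e)
        have h2 : discriminator (graft σ τ hσ hτ h (x 0)) (graft σ τ hσ hτ h (x 1))
          (graft σ τ hσ hτ h (x 2)) = graft σ τ hσ hτ h (x 0) :=
          if_neg fun e => hc (graft_injective hσ hτ h e)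
        rw [h2]
        congr 1
        exact Subtype.ext h1)

end Graft

theorem cone_le_cone {σ τ : List P} (h : σ <:+ τ) : cone τ ≤ cone σ := fun _ hx => h.trans hx

/-- A subuniverse without a root is a cone. -/
theorem exists_eq_cone (U : (sig P).Substructure (alg P)) (hU : Nonempty U)
    (h : ∀ x : Univ P, x ∈ U → x.node ≠ []) :
    ∃ σ : List P, σ.IsChain (· < ·) ∧ σ ≠ [] ∧ U = cone σ := by
  obtain ⟨x, hx, hmin⟩ : ∃ x : Univ P, x ∈ U ∧ ∀ y : Univ P, y ∈ U →
      x.node.length ≤ y.node.length := by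
    obtain ⟨x, hx, hmin⟩ := (measure fun x : Univ P => x.node.length).wf.has_min
      {x : Univ P | x ∈ U} ⟨hU.some.1, hU.some.2⟩
    exact ⟨x, hx, fun y hy => not_lt.1 (hmin y hy)⟩
  refine ⟨x.node, x.isChain_node, h x hx, le_antisymm ?_ ?_⟩
  · intro y hy
    by_contra hc
    -- If `y` is not below the shortest node `x`, ascending from `x` gives a shorter one.
    have h1 : (x.ascend y).node = x.node.tail := by
      rw [show x.ascend y = _ from if_neg hc]
    have h2 := hmin _ (ascend_mem U hx hy)
    rw [h1, List.length_tail] at h2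
    have := List.length_pos_iff.2 (h x hx)
    omega
  · intro (y : Univ P) hy
    obtain ⟨w, hw⟩ : x.node <:+ y.node := hy
    induction w generalizing y with
    | nil =>
      by_cases hb : y.copy = x.copy
      · rwa [show y = x from Univ.ext hw.symm hb]
      · obtain ⟨r, hr⟩ := Option.ne_none_iff_exists'.1
          (mt List.head?_eq_none_iff.1 (h x hx))
        have h1 : x.flip r = ⟨x.node, x.isChain_node, !x.copy⟩ := if_pos hr
        have h2 : y = x.flip r := by
          rw [h1]
          refine Univ.ext hw.symm ?_
          change y.copy = !x.copy
          revert hb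
          cases y.copy <;> cases x.copy <;> simp
        rw [h2]
        exact flip_mem U r hx
    | cons r w ih =>
      have hch : (r :: (w ++ x.node)).IsChain (· < ·) := by
        have := Univ.isChain_node y
        rwa [← hw] at this
      let z : Univ P := ⟨w ++ x.node, hch.tail, y.copy⟩
      have hz : z ∈ U := ih rfl
      obtain ⟨h1, h2⟩ := descend_node (x := z) hch (h z hz)
      rw [show y = z.descend r from Univ.ext (hw.symm.trans h1.symm) h2.symm]
      exact descend_mem U r hz

/-! ### Homomorphisms between branches -/

/-- The subalgebra of the elements below the node `[p]`. -/
noncomputable def branch (p : P) : Alg (sig P) :=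
  (alg P).sub (cone [p]) ⟨(⟨[p], List.isChain_singleton p, true⟩ : Univ P), List.suffix_rfl⟩

/-- For `p < q` the node `[p, q]` lies below `[q]` and has label `p`, so its cone is a copy of
`branch p` inside `branch q`. -/
theorem nonempty_hom_branch {p q : P} (hpq : p ≤ q) : Nonempty (branch p →[sig P] branch q) := by
  rcases hpq.eq_or_lt with rfl | hlt
  · exact ⟨Hom.id _ _⟩
  · exact ⟨(Substructure.inclusion (cone_le_cone (List.suffix_cons p [q]))).toHom.comp
      (graftHom (List.isChain_singleton p) (by simpa using hlt) rfl (List.cons_ne_nil _ _))⟩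

/-- A homomorphism from a product of branches to a branch forces a relation in `P`. -/
theorem exists_le_of_hom {I : Type} {p : I → P} {q : P}
    (f : Alg.prod (fun i => branch (p i)) →[sig P] branch q) : ∃ i, p i ≤ q := by
  let x : Alg.prod (fun i => branch (p i)) := fun i =>
    (⟨(⟨[p i], List.isChain_singleton (p i), true⟩ : Univ P), List.suffix_rfl⟩ : cone [p i])
  let y : Univ P := (show cone [q] from f x).1
  obtain ⟨w, hw⟩ : [q] <:+ y.node := (show cone [q] from f x).2
  obtain ⟨r, hr⟩ : ∃ r, y.node.head? = some r :=
    Option.ne_none_iff_exists'.1 (mt List.head?_eq_none_iff.1 (by simp [← hw]))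
  have hrq : r ≤ q := by
    have hch := y.isChain_node
    rw [← hw] at hch hr
    cases w with
    | nil =>
      simp only [List.nil_append, List.head?_cons, Option.some.injEq] at hr
      exact hr.ge
    | cons a w =>
      simp only [List.cons_append, List.head?_cons, Option.some.injEq] at hr
      subst hr
      have := List.isChain_iff_pairwise.1 hch
      exact (List.rel_of_pairwise_cons this (by simp)).le
  have hflip : y.flip r ≠ y := by
    rw [show y.flip r = ⟨y.node, y.isChain_node, !y.copy⟩ from if_pos hr]
    intro e
    have := congrArg Univ.copy e
    simp at this
  -- If no `p i ≤ q`, then no `p i` equals `r`, so `flip r` fixes `x` and hence its image; but it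
  -- moves `y`.
  by_contra! hcon
  apply hflip
  have hx : Structure.funMap (L := sig P) (n := 1) (Op.flip r) (fun _ => x) = x := by
    funext i
    refine Subtype.ext ?_
    refine if_neg fun e => hcon i ?_
    have e' : some (p i) = some r := e
    exact (Option.some.inj e').trans_le hrq
  have h1 := f.map_fun (n := 1) (Op.flip r) (fun _ => x)
  rw [hx] at h1
  exact (congrArg (fun z : cone [q] => (z.1 : Univ P)) h1).symm

theorem var_branch (p : P) : Var (alg P) (branch p) := fun _ hK h => hK.sub _ _ _ h

theorem var_prod_branch {I : Type} (p : I → P) :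
    Var (alg P) (Alg.prod fun i => branch (p i)) :=
  fun K hK h => hK.prod _ _ fun i => var_branch (p i) K hK h

instance [Finite P] (p : P) : Finite (branch p) :=
  Subtype.finite (α := Univ P)

instance [Finite P] {I : Type} [Finite I] (p : I → P) :
    Finite (Alg.prod fun i => branch (p i)) :=
  Pi.finite (β := fun i => branch (p i))

/-! ### The homomorphism lattice as lower sets -/

/-- The lower set of all `q` such that `C` has no homomorphism to the branch of `q`. -/
def omitted (C : Alg (sig P)) : LowerSet P where
  carrier := {q | IsEmpty (C →[sig P] branch q)}
  lower' := fun _ _ hba ha => ⟨fun f => ha.false ((nonempty_hom_branch hba).some.comp f)⟩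

/-- Only images of `D` in `alg P` matter. A rootless image is isomorphic to some `branch q`; then
`q` is not omitted by `D`, hence not by `C`. -/
theorem nonempty_hom_of_omitted_le [Finite P] {C D : Alg (sig P)} [Finite D]
    (hD : Var (alg P) D) (h : omitted C ≤ omitted D) : Nonempty (C →[sig P] D) := by
  have hfin : Finite (alg P) := isQuasiPrimal_alg.1
  obtain ⟨t, ht⟩ := (isQuasiPrimal_alg (P := P)).2
  refine (hD.separatedBy ht (isAlgebraic_sig P)).nonempty_hom ht (isAlgebraic_sig P) fun k => ?_
  by_cases hroot : ∃ x : Univ P, x ∈ k.range ∧ x.node = []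
  · obtain ⟨x, hx, hx'⟩ := hroot
    exact nonempty_hom_of_root C _ hx hx'
  push Not at hroot
  have hne : Nonempty k.range :=
    ⟨⟨k (Classical.arbitrary D), Hom.mem_range.2 ⟨_, rfl⟩⟩⟩
  obtain ⟨σ, hσ, hσne, hU⟩ := exists_eq_cone k.range hne hroot
  obtain ⟨q, hq⟩ := Option.ne_none_iff_exists'.1 (mt List.head?_eq_none_iff.1 hσne)
  have hDq : D →[sig P] branch q :=
    (graftHom (τ := [q]) hσ (List.isChain_singleton q) hq hσne).comp
      (k.codRestrict (cone σ) fun c => by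
        rw [← hU]
        exact Hom.mem_range.2 ⟨c, rfl⟩)
  have hCq : Nonempty (C →[sig P] branch q) := by
    by_contra hc
    exact (h (show q ∈ omitted C from not_nonempty_iff.1 hc)).false hDq
  rw [hU]
  exact ⟨(graftHom (σ := [q]) (List.isChain_singleton q) hσ hq.symm
    (List.cons_ne_nil _ _)).comp hCq.some⟩

/-- Projections reach each `branch q` with `q ∉ W`; for `q ∈ W`, a homomorphism would put some `p ∉
W` below `q`. When `W` is everything, the product is the one-element algebra. -/
theorem exists_omitted_eq (W : LowerSet P) :
    omitted (Alg.prod fun i : {p : P // p ∉ W} => branch i.1) = W := by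
  refine SetLike.ext fun q => ⟨fun hq => ?_, fun hq => IsEmpty.mk fun f => ?_⟩
  · by_contra hqW
    exact hq.false (prodProj (fun i : {p : P // p ∉ W} => branch i.1) ⟨q, hqW⟩)
  · obtain ⟨i, hi⟩ := exists_le_of_hom f
    exact i.2 (W.lower hi hq)

/-- The homomorphism lattice of `alg P` is the lattice of lower sets of `P`. -/
theorem nonempty_homLattice_orderIso [Finite P] :
    Nonempty ((alg P).HomLattice ≃o LowerSet P) := by
  have hle : ∀ C D : VarFin (alg P), omitted C.1 ≤ omitted D.1 ↔ C ≤ D := fun C D => by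
    have := D.2.2
    exact ⟨nonempty_hom_of_omitted_le D.2.1, fun ⟨f⟩ q hq => ⟨fun g => hq.false (g.comp f)⟩⟩
  let φ : (alg P).HomLattice → LowerSet P :=
    Quotient.lift (fun C : VarFin (alg P) => omitted C.1)
      fun C D h => le_antisymm ((hle C D).2 h.1) ((hle D C).2 h.2)
  have hφ : ∀ a b, φ a ≤ φ b ↔ a ≤ b := by
    rintro ⟨C⟩ ⟨D⟩
    exact hle C D
  refine ⟨RelIso.ofSurjective (OrderEmbedding.ofMapLEIff φ hφ) fun W => ?_⟩
  exact ⟨toAntisymmetrization _ (⟨_, var_prod_branch _, inferInstance⟩ : VarFin (alg P)),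
    exists_omitted_eq W⟩

end ChainAlg

/-! ### Birkhoff representation and conclusion -/

/-- A finite distributive lattice is the lattice of lower sets of a finite poset in `Type`. -/
theorem exists_orderIso_lowerSet (L : Type*) [DistribLattice L] [Finite L] [Nonempty L] :
    ∃ (P : Type) (_ : PartialOrder P), Finite P ∧ Nonempty (LowerSet P ≃o L) := by
  classical
  have : Fintype L := Fintype.ofFinite L
  let _ : OrderBot L := Fintype.toOrderBot L
  -- `L` may live in any universe, while signatures and carriers are in `Type`.
  let e := equivShrink.{0} {a : L // SupIrred a}
  let _ : PartialOrder (Shrink.{0} {a : L // SupIrred a}) :=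
    PartialOrder.lift e.symm e.symm.injective
  let i : Shrink.{0} {a : L // SupIrred a} ≃o {a : L // SupIrred a} := ⟨e.symm, Iff.rfl⟩
  exact ⟨_, inferInstance, Finite.of_equiv _ e,
    ⟨(LowerSet.map i).trans OrderIso.lowerSetSupIrred.symm⟩⟩

theorem theorem4p1 (L : Type*) [DistribLattice L] [Finite L] [Nonempty L] :
    ∃ (S : FirstOrder.Language.{0, 0}) (_ : S.IsAlgebraic) (Q : Alg S),
      Q.IsQuasiPrimal ∧ Nonempty (Q.HomLattice ≃o L) := by
  obtain ⟨P, _, _, ⟨e⟩⟩ := exists_orderIso_lowerSet L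
  obtain ⟨i⟩ := ChainAlg.nonempty_homLattice_orderIso (P := P)
  exact ⟨ChainAlg.sig P, ChainAlg.isAlgebraic_sig P, ChainAlg.alg P,
    ChainAlg.isQuasiPrimal_alg, ⟨i.trans e⟩⟩
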